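/- Let $q$ be a prime power and $k,n$ natural numbers. An $(n,k,q)$-MDS code is a set of $q^k$ words of length $n$ over an alphabet of size $q$, no two of which agree in as many as $k$ coordinate positions; it is linear if the alphabet is $GF(q)$ and the code is a $k$-dimensional subspace of $GF(q)^n$. An $(n+1,k,q)$-MDS code $C'$ over the same alphabet extends $C$ if $C$ is obtained by deleting some fixed coordinate position from the words of $C'$. A code over $GF(q)$ is LE if it is equivalent to a linear code (a subspace), that is, it arises from one by permuting the coordinate positions and applying to each coordinate a permutation of the alphabet. For a set $S$ of $q$ points of $PG(2,q)$ off a line $\ell$, let $R_\ell(S)$ be the set of points $PQ\cap\ell$ with $P\neq Q$ in $S$. A set $A$ of points of $\ell$ is primitive if every such $S$ with $R_\ell(S)\subseteq A$ is contained in a line. Let $\mathcal P(q)$ be the size of the smallest non-primitive set of collinear points in $PG(2,q)$ (with $\mathcal P(2)=\infty$, since for $q=2$ every set is primitive). Theorem. Let $C$ be a linear $(n,k,q)$-MDS code. If $n>q-\mathcal P(q)+k$, then every (not necessarily linear) $(n+1,k,q)$-MDS code $C'$ extending $C$ is LE. -/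

import Mathlib

open scoped LinearAlgebra.Projectivization

/-- A set `C` of words of length `n` over the alphabet `A` is an `(n, k, q)`-MDS code: the alphabet
has size `q`, there are `q ^ k` words, and no two words agree in as many as `k` coordinate
positions. -/
def IsMDSCode {A : Type*} {n : ℕ} (k q : ℕ) (C : Set (Fin n → A)) : Prop :=
  Finite A ∧ Nat.card A = q ∧ C.ncard = q ^ k ∧
    ∀ v ∈ C, ∀ w ∈ C, v ≠ w → {i : Fin n | v i = w i}.ncard < k

/-- A linear `(n, k, q)`-MDS code: a `k`-dimensional subspace of `F ^ n` which is an
`(n, k, q)`-MDS code over the alphabet `F`. -/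
def IsLinearMDSCode {F : Type*} [Field F] {n : ℕ} (k q : ℕ) (C : Set (Fin n → F)) : Prop :=
  IsMDSCode k q C ∧
    ∃ D : Submodule F (Fin n → F), (D : Set (Fin n → F)) = C ∧ Module.finrank F D = k

/-- `C'`, an `(m, k, q)`-MDS code, is an extension of the code `C` of length `n < m`: deleting
some fixed `m - n` coordinate positions (those outside the range of `e`) from the words of `C'`
gives `C`. -/
def IsMDSExtension {A : Type*} {n m : ℕ} (k q : ℕ) (C : Set (Fin n → A)) (C' : Set (Fin m → A)) :
    Prop :=
  IsMDSCode k q C' ∧ n < m ∧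
    ∃ e : Fin n ↪o Fin m, (fun (w : Fin m → A) (i : Fin n) => w (e i)) '' C' = C

/-- Two codes are equivalent if one arises from the other by permuting the coordinate positions and
applying to each coordinate a permutation of the alphabet. (A code is a set of words, so that
permuting the rows of its matrix form has no effect.) -/
def CodeEquivalent {A : Type*} {n : ℕ} (C₁ C₂ : Set (Fin n → A)) : Prop :=
  ∃ (σ : Equiv.Perm (Fin n)) (τ : Fin n → Equiv.Perm A),
    C₂ = (fun (w : Fin n → A) (i : Fin n) => τ i (w (σ i))) '' C₁

/-- A code over `F` is of type LE if it is equivalent to a linear code over `F`. -/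
def IsLE {F : Type*} [Field F] {n : ℕ} (C : Set (Fin n → F)) : Prop :=
  ∃ D : Submodule F (Fin n → F), CodeEquivalent (D : Set (Fin n → F)) C

/-- The points of the projective plane `PG(2, F)`. -/
abbrev PG2 (F : Type*) [Field F] : Type _ := ℙ F (Fin 3 → F)

/-- A set of points of `PG(2, F)` is a line if it consists of the points lying in some
two-dimensional subspace of `F ^ 3`. -/
def IsLine {F : Type*} [Field F] (l : Set (PG2 F)) : Prop :=
  ∃ W : Submodule F (Fin 3 → F), Module.finrank F W = 2 ∧ l = {P : PG2 F | P.submodule ≤ W}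

/-- The Rédei set of `S` with respect to `l`: the points in which `l` meets the lines joining
two distinct points of `S`. -/
def redeiSet {F : Type*} [Field F] (l S : Set (PG2 F)) : Set (PG2 F) :=
  {X | X ∈ l ∧ ∃ P ∈ S, ∃ Q ∈ S, P ≠ Q ∧ ∃ m : Set (PG2 F), IsLine m ∧ P ∈ m ∧ Q ∈ m ∧ X ∈ m}

/-- A set `A` of points of the line `l` is primitive if every set `S` of `q = |F|` points off `l`
whose Rédei set is contained in `A` is contained in a line. -/
def IsPrimitiveSet {F : Type*} [Field F] (l A : Set (PG2 F)) : Prop :=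
  ∀ S : Set (PG2 F), S.ncard = Nat.card F → Disjoint S l → redeiSet l S ⊆ A →
    ∃ m : Set (PG2 F), IsLine m ∧ S ⊆ m

/-- The size of the smallest non-primitive set of collinear points in `PG(2, F)`. For `|F| ≥ 3`
this is a natural number; for `|F| = 2` every set is primitive and the value is `⊤`. -/
noncomputable def minNonPrimitive (F : Type*) [Field F] : ℕ∞ :=
  sInf {m : ℕ∞ | ∃ l A : Set (PG2 F), IsLine l ∧ A ⊆ l ∧ ¬ IsPrimitiveSet l A ∧ A.encard = m}

/-!
Deleting one coordinate is a bijection from `C'` onto the linear code `C`, so `C'` is the graph of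
a function `f : C → F`, the new column, and `f u ≠ f v` whenever the distinct words `u` and `v` of
`C` agree in `k - 1` coordinates. It suffices to write `f` as a linear functional followed by a
permutation of `F`.

The first `k` coordinates form an information set of `C`; let `b` be the basis of `C` dual to them.
On a coordinate plane `u + ⟨b i, b j⟩` of `C` the function `f` is a Latin square. Moreover, each
of the `n - k` coordinates outside the information set is constant on one parallel class of lines
of the plane, and `f` is injective on these lines. The slopes are distinct, since a nonzero word
cannot vanish in `k` coordinates. So a level set of `f` in the plane is a set of `q` points
determining at most `q - (n - k)` directions, which is smaller than `minNonPrimitive F`: it is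
contained in a line. The level sets are disjoint, hence parallel lines
(`exists_eq_apply_add_mul_zero`).

Consequently, within each coordinate plane, `f` absorbs a step along `b j` into a multiple of a
step along `b i`. Comparing the three planes of a coordinate cube shows that this multiple does not
depend on the plane (`slope_eq_of_plane`). Collecting all steps into the single direction `b i`
yields `f u = f (L u • b i)` for a linear functional `L` (`exists_linear_factor_of_plane`), and
`f` is a bijection on the line spanned by `b i`.
-/

/-! ### Level sets of functions on the affine plane -/

section Plane

variable {F : Type*} [Field F]

theorem affinePoint_ne_zero (s t : F) : (![1, s, t] : Fin 3 → F) ≠ 0 :=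
  fun h => one_ne_zero (congrFun h 0)

theorem slopePoint_ne_zero (c : F) : (![0, 1, c] : Fin 3 → F) ≠ 0 :=
  fun h => one_ne_zero (congrFun h 1)

/-- The affine point `(s, t)`, as the point `(1 : s : t)` of the projective plane. -/
def affinePoint (s t : F) : PG2 F := Projectivization.mk F ![1, s, t] (affinePoint_ne_zero s t)

/-- The point at infinity `(0 : 1 : c)` in the direction of slope `c`. -/
def slopePoint (c : F) : PG2 F := Projectivization.mk F ![0, 1, c] (slopePoint_ne_zero c)

theorem mk_submodule_le_iff (v : Fin 3 → F) (hv : v ≠ 0) (W : Submodule F (Fin 3 → F)) :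
    (Projectivization.mk F v hv).submodule ≤ W ↔ v ∈ W := by
  rw [Projectivization.submodule_mk, Submodule.span_singleton_le_iff_mem]

/-- The line at infinity `x₀ = 0`. -/
def lineAtInfinity (F : Type*) [Field F] : Set (PG2 F) :=
  {P : PG2 F | P.submodule ≤ LinearMap.ker (LinearMap.proj (R := F) (φ := fun _ : Fin 3 => F) 0)}

theorem isLine_lineAtInfinity : IsLine (lineAtInfinity F) := by
  refine ⟨_, ?_, rfl⟩
  have hsurj : Function.Surjective (LinearMap.proj (R := F) (φ := fun _ : Fin 3 => F) 0) :=
    fun x => ⟨fun _ => x, rfl⟩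
  have h := LinearMap.finrank_range_add_finrank_ker
    (LinearMap.proj (R := F) (φ := fun _ : Fin 3 => F) 0)
  rw [LinearMap.range_eq_top.2 hsurj, finrank_top] at h
  simp only [Module.finrank_self, Module.finrank_fin_fun] at h
  omega

theorem mk_mem_lineAtInfinity_iff (v : Fin 3 → F) (hv : v ≠ 0) :
    Projectivization.mk F v hv ∈ lineAtInfinity F ↔ v 0 = 0 := by
  simp [lineAtInfinity]

/-- A two-dimensional subspace of `F ^ 3` lies in a plane `α x₀ + β x₁ + γ x₂ = 0`. -/
theorem exists_equation_of_finrank_eq_two (W : Submodule F (Fin 3 → F))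
    (hW : Module.finrank F W = 2) :
    ∃ α β γ : F, ¬ (α = 0 ∧ β = 0 ∧ γ = 0) ∧
      ∀ w ∈ W, α * w 0 + β * w 1 + γ * w 2 = 0 := by
  have hlt : W < ⊤ := by
    refine lt_top_iff_ne_top.2 fun h => ?_
    rw [h, finrank_top, Module.finrank_fin_fun] at hW
    omega
  obtain ⟨φ, hφ, hle⟩ := Submodule.exists_le_ker_of_lt_top W hlt
  have hsum : ∀ w : Fin 3 → F, φ w = φ (Pi.single 0 1) * w 0 + φ (Pi.single 1 1) * w 1
      + φ (Pi.single 2 1) * w 2 := by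
    intro w
    have hw : w = w 0 • Pi.single 0 1 + w 1 • Pi.single 1 1 + w 2 • Pi.single 2 1 := by
      funext i
      fin_cases i <;> simp
    conv_lhs => rw [hw]
    simp only [map_add, map_smul, smul_eq_mul, mul_comm]
  refine ⟨_, _, _, ?_, fun w hw => (hsum w).symm.trans (hle hw)⟩
  rintro ⟨h0, h1, h2⟩
  exact hφ (LinearMap.ext fun w => by rw [hsum, h0, h1, h2]; simp)

/-- If the graph of `ψ` omits the slopes in `M`, and the remaining slopes are fewer than
the smallest non-primitive set, then `ψ` is affine. -/
theorem affine_of_forall_slope_notMem [Finite F] (ψ : F → F) (M : Finset F)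
    (hM : (Nat.card F : ℕ∞) < M.card + minNonPrimitive F)
    (hψ : ∀ s s' : F, s ≠ s' → ∀ c ∈ M, ψ s' - ψ s ≠ c * (s' - s)) :
    ∃ l m : F, ∀ s, ψ s = m + l * s := by
  classical
  set A : Set (PG2 F) := slopePoint '' (↑M : Set F)ᶜ with hA
  have hinf : ∀ c : F, slopePoint c ∈ lineAtInfinity F := fun c =>
    (mk_mem_lineAtInfinity_iff _ _).2 rfl
  have hprim : IsPrimitiveSet (lineAtInfinity F) A := by
    by_contra hnot
    have hle : minNonPrimitive F ≤ A.encard :=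
      sInf_le ⟨_, A, isLine_lineAtInfinity, by rintro _ ⟨c, -, rfl⟩; exact hinf c, hnot, rfl⟩
    have hcard : (M.card : ℕ∞) + ((↑M : Set F)ᶜ).encard = Nat.card F := by
      rw [← Set.encard_coe_eq_coe_finsetCard, Set.encard_add_encard_compl, Set.encard_univ,
        ENat.card_eq_coe_natCard]
    refine absurd hM (not_lt.2 ?_)
    rw [← hcard]
    gcongr
    exact hle.trans (Set.encard_image_le _ _)
  have hmkinj : Function.Injective fun s => affinePoint s (ψ s) := by
    intro s s' h
    obtain ⟨a, ha⟩ := (Projectivization.mk_eq_mk_iff' F _ _ _ _).1 h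
    have h0 := congrFun ha 0
    have h1 := congrFun ha 1
    simp at h0 h1
    rw [h0, one_mul] at h1
    exact h1.symm
  obtain ⟨m, ⟨W, hW, rfl⟩, hSm⟩ := hprim (Set.range fun s => affinePoint s (ψ s)) (by
      rw [← Set.image_univ, Set.ncard_image_of_injective _ hmkinj, Set.ncard_univ]) (by
      rw [Set.disjoint_left]
      rintro _ ⟨s, rfl⟩ h
      exact one_ne_zero ((mk_mem_lineAtInfinity_iff _ _).1 h)) (by
      rintro X ⟨hX, _, ⟨s, rfl⟩, _, ⟨s', rfl⟩, hne, _, ⟨W, hW, rfl⟩, hs, hs', hXW⟩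
      have hss : s ≠ s' := fun h => hne (by rw [h])
      obtain ⟨α, β, γ, hnz, heq⟩ := exists_equation_of_finrank_eq_two W hW
      have e := heq _ ((mk_submodule_le_iff _ _ _).1 hs)
      have e' := heq _ ((mk_submodule_le_iff _ _ _).1 hs')
      induction X using Projectivization.ind with
      | h x hx =>
        have hx0 := (mk_mem_lineAtInfinity_iff _ _).1 hX
        have ex := heq _ ((mk_submodule_le_iff _ _ _).1 hXW)
        simp at e e'
        rw [hx0] at ex
        have hγ : γ ≠ 0 := by
          rintro rfl
          have hβ : β = 0 := by
            have : β * (s' - s) = 0 := by linear_combination e' - e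
            exact (mul_eq_zero.1 this).resolve_right (sub_ne_zero.2 hss.symm)
          exact hnz ⟨by simpa [hβ] using e, hβ, rfl⟩
        have hx2 : x 2 = -β / γ * x 1 := by
          field_simp
          linear_combination ex
        have hx1 : x 1 ≠ 0 := by
          intro h
          apply hx
          funext i
          fin_cases i
          · exact hx0
          · exact h
          · simpa [h] using hx2
        refine ⟨-β / γ, fun hmem => hψ s s' hss _ hmem ?_, ?_⟩
        · field_simp
          linear_combination e' - e
        · refine (Projectivization.mk_eq_mk_iff' F _ _ _ _).2 ⟨(x 1)⁻¹, ?_⟩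
          funext i
          fin_cases i
          · simp [hx0]
          · simp [hx1]
          · simp [hx2]
            field_simp)
  obtain ⟨α, β, γ, hnz, heq⟩ := exists_equation_of_finrank_eq_two W hW
  have e : ∀ s, α + β * s + γ * ψ s = 0 := fun s => by
    simpa using heq _ ((mk_submodule_le_iff _ _ _).1 (hSm ⟨s, rfl⟩))
  have hγ : γ ≠ 0 := by
    rintro rfl
    have h0 : α = 0 := by simpa using e 0
    exact hnz ⟨h0, by simpa [h0] using e 1, rfl⟩
  refine ⟨-β / γ, -α / γ, fun s => ?_⟩
  field_simp
  linear_combination e s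

/-- A Latin square whose level sets omit the slopes in `M` is constant on a parallel class of
lines. Each level set is the graph of an affine function, and since level sets are disjoint,
all these functions have the same slope. -/
theorem exists_eq_apply_add_mul_zero [Finite F] (g : F → F → F) (M : Finset F)
    (hM : (Nat.card F : ℕ∞) < M.card + minNonPrimitive F)
    (hg₁ : ∀ s, Function.Injective (g s)) (hg₂ : ∀ t, Function.Injective fun s => g s t)
    (hgM : ∀ c ∈ M, ∀ s t r, r ≠ 0 → g (s + r) (t + c * r) ≠ g s t) :
    ∃ c, ∀ s t, g s t = g (s + c * t) 0 := by
  have hsurj : ∀ a s, ∃ t, g s t = a := fun a s => Finite.surjective_of_injective (hg₁ s) a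
  choose ψ hψ using hsurj
  have haff : ∀ a, ∃ l m : F, ∀ s, ψ a s = m + l * s := fun a =>
    affine_of_forall_slope_notMem (ψ a) M hM fun s s' hss c hc h => by
      apply hgM c hc s (ψ a s) (s' - s) (sub_ne_zero.2 hss.symm)
      rw [← h, add_sub_cancel, add_sub_cancel, hψ, hψ]
  choose l m hlm using haff
  have hl : ∀ a a', l a = l a' := by
    intro a a'
    by_contra hne
    have hsub : l a - l a' ≠ 0 := sub_ne_zero.2 hne
    -- the abscissa at which two lines of different slopes meet
    let s := (m a' - m a) / (l a - l a')
    have hs : ψ a s = ψ a' s := by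
      rw [hlm, hlm]
      simp only [s]
      field_simp
      ring
    have : a = a' := by rw [← hψ a s, hs, hψ]
    exact hne (by rw [this])
  have hl0 : l 0 ≠ 0 := by
    intro h0
    refine zero_ne_one (α := F) (hg₂ (m 0) ?_)
    have key : ∀ s, g s (m 0) = 0 := fun s => by
      conv_rhs => rw [← hψ 0 s, hlm, h0, zero_mul, add_zero]
    exact (key 0).trans (key 1).symm
  refine ⟨-(l 0)⁻¹, fun s t => ?_⟩
  have ht : t = ψ (g s t) s := hg₁ s (hψ _ _).symm
  have hz : ψ (g s t) (s + -(l 0)⁻¹ * t) = 0 := by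
    rw [hlm, hl _ 0] at ht ⊢
    field_simp
    linear_combination -ht
  conv_lhs => rw [← hψ (g s t) (s + -(l 0)⁻¹ * t), hz]

end Plane

/-! ### From coordinate planes to the whole space -/

section Gluing

variable {F V : Type*} [Field F] [AddCommGroup V] [Module F V] {ι : Type*}

/-- The slope at which `f` absorbs a step along `v j` into a step along `v i` does not depend on
the base point: in the directions `v i` and `v j` this is seen within one plane, and in a third
direction `v m` by comparing the three planes spanned by `v i`, `v j` and `v m`. -/
theorem slope_eq_of_plane (v : ι → V) (f : V → F)
    (hinj : ∀ u i, Function.Injective fun s : F => f (u + s • v i))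
    (c : V → ι → ι → F)
    (hc : ∀ u i j, i ≠ j → ∀ s t : F, f (u + s • v i + t • v j) = f (u + (s + c u i j * t) • v i))
    (u : V) (i j m : ι) (hij : i ≠ j) (r : F) : c (u + r • v m) i j = c u i j := by
  have hc0 : ∀ u i j, i ≠ j → ∀ t : F, f (u + t • v j) = f (u + (c u i j * t) • v i) :=
    fun u i j h t => by simpa using hc u i j h 0 t
  have hstep : ∀ t, f (u + r • v m + t • v j) =
      f (u + r • v m + (c (u + r • v m) i j * t) • v i) := hc0 _ i j hij
  by_cases hmi : m = i
  · subst hmi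
    have h := hstep 1
    rw [hc u m j hij, add_assoc u, ← add_smul] at h
    have := hinj u m h
    linear_combination -this
  by_cases hmj : m = j
  · subst hmj
    have h := hstep 1
    rw [add_assoc u, ← add_smul, hc0 u i m hij, add_right_comm, hc u i m hij] at h
    have := hinj u i h
    linear_combination -this
  · have key : ∀ t, c (u + r • v m) i j * t + c u i m * r = c u i j * (t + c u j m * r) := by
      intro t
      have h := hstep t
      rw [add_right_comm, hc u j m (Ne.symm hmj), hc0 u i j hij, add_right_comm,
        hc u i m (Ne.symm hmi)] at h
      exact (hinj u i h).symm
    linear_combination key 1 - key 0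

/-- A function that is injective along the basis directions and constant on parallel lines
in each coordinate plane factors through a linear functional. -/
theorem exists_linear_factor_of_plane [Fintype ι] (b : Module.Basis ι F V) (f : V → F) (i : ι)
    (hinj : ∀ u i, Function.Injective fun s : F => f (u + s • b i))
    (hplane : ∀ u i j, i ≠ j → ∃ c : F, ∀ s t : F,
      f (u + s • b i + t • b j) = f (u + (s + c * t) • b i)) :
    ∃ L : V →ₗ[F] F, ∀ u, f u = f (L u • b i) := by
  classical
  choose! c hc using hplane
  have hconst : ∀ j, i ≠ j → ∀ u, c u i j = c 0 i j := by
    intro j hij u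
    have h : ∀ S : Finset ι, c (∑ m ∈ S, b.repr u m • b m) i j = c 0 i j := by
      intro S
      induction S using Finset.induction_on with
      | empty => simp
      | insert m S hm ih =>
        rw [Finset.sum_insert hm, add_comm, slope_eq_of_plane b f hinj c hc _ _ _ _ hij, ih]
    rw [← h Finset.univ, b.sum_repr]
  let d : ι → F := fun j => if i = j then 1 else c 0 i j
  have hd : ∀ u j (t : F), f (u + t • b j) = f (u + (d j * t) • b i) := by
    intro u j t
    by_cases hij : i = j
    · subst hij; simp [d]
    · have := hc u i j hij 0 t
      rw [hconst j hij] at this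
      simpa [d, hij] using this
  refine ⟨∑ j, d j • b.coord j, fun u => ?_⟩
  have h : ∀ (S : Finset ι) (w : V),
      f (w + ∑ j ∈ S, b.repr u j • b j) = f (w + (∑ j ∈ S, d j * b.repr u j) • b i) := by
    intro S
    induction S using Finset.induction_on with
    | empty => simp
    | insert j S hj ih =>
      intro w
      rw [Finset.sum_insert hj, Finset.sum_insert hj, ← add_assoc, ih, add_right_comm, hd,
        add_assoc, ← add_smul, add_comm (d j * _)]
  simpa [b.sum_repr, LinearMap.sum_apply] using h Finset.univ 0

end Gluing

/-! ### Extensions of linear MDS codes -/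

section Codes

variable {F : Type*} [Field F] {n k : ℕ}

/-- The new column `f` of an extension of the linear MDS code `D` is a linear functional followed
by a permutation of the alphabet. -/
theorem exists_perm_linear_of_column [Finite F] (D : Submodule F (Fin n → F))
    (hDk : Module.finrank F D = k)
    (hD : ∀ u ∈ D, u ≠ 0 → {i | u i = 0}.ncard < k) (f : D → F)
    (hf : ∀ u v : D, u ≠ v → f u = f v → {i | u.1 i = v.1 i}.ncard + 1 < k)
    (hn : (Nat.card F : ℕ∞) + (k : ℕ∞) < (n : ℕ∞) + minNonPrimitive F) :
    ∃ (L : D →ₗ[F] F) (h : Equiv.Perm F), ∀ u, f u = h (L u) := by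
  classical
  obtain rfl | hk := Nat.eq_zero_or_pos k
  · have : Subsingleton D := Module.finrank_zero_iff.1 hDk
    exact ⟨0, Equiv.addRight (f 0), fun u => by simp [Subsingleton.elim u 0]⟩
  have hkn : k ≤ n := by
    have := Submodule.finrank_le D
    rwa [hDk, Module.finrank_fin_fun] at this
  have hzero : ∀ (v : D) (T : Finset (Fin n)), k ≤ T.card → (∀ i ∈ T, v.1 i = 0) → v = 0 := by
    intro v T hT hv
    by_contra hne
    have h1 := hD v.1 v.2 (fun h => hne (Subtype.ext h))
    have h2 := Set.ncard_le_ncard (s := (↑T : Set (Fin n))) (t := {i | v.1 i = 0}) hv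
    rw [Set.ncard_coe_finset] at h2
    omega
  have hfne : ∀ (u v : D) (T : Finset (Fin n)), k ≤ T.card + 1 → (∀ i ∈ T, v.1 i = 0) → v ≠ 0 →
      f (u + v) ≠ f u := by
    intro u v T hT hv hne heq
    have h1 := hf (u + v) u (by simpa using hne) heq
    have h2 := Set.ncard_le_ncard (s := (↑T : Set (Fin n)))
      (t := {i | (u + v).1 i = u.1 i}) (fun i hi => by simp [hv i hi])
    rw [Set.ncard_coe_finset] at h2
    omega
  -- the first `k` coordinates form an information set
  let e : Fin k ↪ Fin n := Fin.castLEEmb hkn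
  let p : D →ₗ[F] (Fin k → F) := (LinearMap.funLeft F F e).comp D.subtype
  have hp : Function.Injective p := by
    rw [injective_iff_map_eq_zero]
    refine fun v hv => hzero v (Finset.univ.map e) (by simp) fun i hi => ?_
    obtain ⟨j, -, rfl⟩ := Finset.mem_map.1 hi
    exact congrFun hv j
  let E : D ≃ₗ[F] (Fin k → F) := LinearEquiv.ofInjectiveOfFinrankEq p hp (by simp [hDk])
  let b : Module.Basis (Fin k) F D := Module.Basis.ofEquivFun E
  have hb : ∀ i j, (b i).1 (e j) = if j = i then 1 else 0 := by
    intro i j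
    have : p (b i) = Pi.single i 1 := by
      change E (b i) = _
      simp [b]
    have := congrFun this j
    rwa [Pi.single_apply] at this
  have hb0 : ∀ i, b i ≠ 0 := fun i => b.ne_zero i
  have hinj : ∀ u i, Function.Injective fun s : F => f (u + s • b i) := by
    intro u i s s' hss
    by_contra hne
    refine hfne (u + s' • b i) ((s - s') • b i) ((Finset.univ.erase i).map e) (by simp; omega) ?_
      (smul_ne_zero (sub_ne_zero.2 hne) (hb0 i)) ?_
    · intro m hm
      obtain ⟨j, hj, rfl⟩ := Finset.mem_map.1 hm
      simp [hb, Finset.ne_of_mem_erase hj]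
    · simp only at hss
      rw [← hss, add_assoc, ← add_smul, add_sub_cancel]
  have hplane : ∀ u i j, i ≠ j → ∃ c : F, ∀ s t : F,
      f (u + s • b i + t • b j) = f (u + (s + c * t) • b i) := by
    intro u i j hij
    -- the coordinates that vanish on the plane spanned by `b i` and `b j`
    let T : Finset (Fin n) := ((Finset.univ.erase i).erase j).map e
    have hT : T.card + 2 = k := by
      have h1 : ((Finset.univ.erase i).erase j).card = k - 1 - 1 := by
        rw [Finset.card_erase_of_mem (by simp [hij.symm]), Finset.card_erase_of_mem (by simp),
          Finset.card_fin]
      have : 1 < k := by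
        have := i.2; have := j.2; have := Fin.val_ne_of_ne hij; omega
      simp only [T, Finset.card_map, h1]
      omega
    have hTe : ∀ r c : F, ∀ m ∈ T, (r • (b i + c • b j)).1 m = 0 := by
      intro r c m hm
      obtain ⟨l, hl, rfl⟩ := Finset.mem_map.1 hm
      simp only [Finset.mem_erase, Finset.mem_univ, and_true] at hl
      simp [hb, hl.1, hl.2]
    let N : Finset (Fin n) := (Finset.univ.map e)ᶜ
    have hNT : ∀ m ∈ N, m ∉ T := fun m hm hmT =>
      Finset.mem_compl.1 hm (Finset.map_subset_map.2 (Finset.subset_univ _) hmT)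
    have hbj : ∀ m ∈ N, (b j).1 m ≠ 0 := by
      intro m hm h0
      refine hb0 j (hzero (b j) (insert m ((Finset.univ.erase j).map e)) ?_ ?_)
      · rw [Finset.card_insert_of_notMem fun hmT =>
          Finset.mem_compl.1 hm (Finset.map_subset_map.2 (Finset.subset_univ _) hmT)]
        simp; omega
      · intro l hl
        obtain rfl | hl := Finset.mem_insert.1 hl
        · exact h0
        · obtain ⟨l', hl', rfl⟩ := Finset.mem_map.1 hl
          simp [hb, Finset.ne_of_mem_erase hl']
    -- `slope m` is the slope of the lines in this plane on which coordinate `m` is constant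
    let slope : Fin n → F := fun m => -(b i).1 m / (b j).1 m
    have hslope : ∀ r : F, ∀ m ∈ N, (r • (b i + slope m • b j)).1 m = 0 := by
      intro r m hm
      have := hbj m hm
      simp only [slope, Submodule.coe_smul, Submodule.coe_add, Pi.smul_apply, Pi.add_apply,
        smul_eq_mul]
      field_simp
      ring
    have hne0 : ∀ r c : F, r ≠ 0 → r • (b i + c • b j) ≠ 0 := by
      intro r c hr h
      have := congrFun (congrArg Subtype.val h) (e i)
      simp [hb, hij, hr] at this
    have hsinj : Set.InjOn slope N := by
      intro m hm m' hm' heq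
      by_contra hne
      refine hne0 1 (slope m) one_ne_zero (hzero _ (insert m (insert m' T)) ?_ ?_)
      · rw [Finset.card_insert_of_notMem (by simp [hne, hNT m hm]),
          Finset.card_insert_of_notMem (hNT m' hm')]
        omega
      · intro l hl
        obtain rfl | hl := Finset.mem_insert.1 hl
        · exact hslope 1 _ hm
        obtain rfl | hl := Finset.mem_insert.1 hl
        · rw [heq]; exact hslope 1 _ hm'
        · exact hTe _ _ l hl
    have hcard : (N.image slope).card = n - k := by
      rw [Finset.card_image_of_injOn hsinj, Finset.card_compl]
      simp
    obtain ⟨c, hc⟩ := exists_eq_apply_add_mul_zero (fun s t => f (u + s • b i + t • b j))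
      (N.image slope) (by
        rw [hcard]
        have h : (n : ℕ∞) = ((n - k : ℕ) : ℕ∞) + k := by
          rw [← Nat.cast_add, Nat.sub_add_cancel hkn]
        rw [h, add_right_comm] at hn
        exact lt_of_add_lt_add_right hn)
      (fun s => hinj _ j)
      (fun t s s' h => by
        simp only [add_right_comm u] at h
        exact hinj _ i h)
      (by
        intro c hc s t r hr
        obtain ⟨m, hm, rfl⟩ := Finset.mem_image.1 hc
        have := hfne (u + s • b i + t • b j) (r • (b i + slope m • b j)) (insert m T) (by
          rw [Finset.card_insert_of_notMem (hNT m hm)]; omega) (by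
          intro l hl
          obtain rfl | hl := Finset.mem_insert.1 hl
          · exact hslope r _ hm
          · exact hTe _ _ l hl) (hne0 r _ hr)
        convert this using 2
        module)
    exact ⟨c, fun s t => by simpa using hc s t⟩
  let i : Fin k := ⟨0, hk⟩
  obtain ⟨L, hL⟩ := exists_linear_factor_of_plane b f i hinj hplane
  have hbij : Function.Bijective fun s : F => f (s • b i) :=
    Finite.injective_iff_bijective.1 (by simpa using hinj 0 i)
  exact ⟨L, Equiv.ofBijective _ hbij, hL⟩

/-- An order embedding of `Fin n` into `Fin (n + 1)` skips exactly one position. -/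
theorem exists_eq_succAbove (e : Fin n ↪o Fin (n + 1)) : ∃ p : Fin (n + 1), ⇑e = p.succAbove := by
  have hns : ¬ Function.Surjective e := fun h => by
    have := Fintype.card_le_of_surjective _ h
    simp at this
  obtain ⟨p, hp⟩ := not_forall.1 hns
  refine ⟨p, ?_⟩
  have hsub : Set.range e ⊆ Set.range p.succAbove := by
    rw [Fin.range_succAbove]
    rintro _ ⟨j, rfl⟩ h
    exact hp ⟨j, h⟩
  have hrange : Set.range e = Set.range p.succAbove :=
    Set.eq_of_subset_of_ncard_le hsub (by
      rw [← Set.image_univ, ← Set.image_univ,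
        Set.ncard_image_of_injective _ Fin.succAbove_right_injective,
        Set.ncard_image_of_injective _ e.injective])
  exact (e.strictMono.range_inj (Fin.strictMono_succAbove p)).1 hrange

end Codes

theorem mainTheorem2 {F : Type*} [Field F] [Finite F] (n k q : ℕ) (hq : Nat.card F = q)
    (C : Set (Fin n → F)) (hC : IsLinearMDSCode k q C)
    (hn : (q : ℕ∞) + (k : ℕ∞) < (n : ℕ∞) + minNonPrimitive F)
    (C' : Set (Fin (n + 1) → F)) (hC' : IsMDSExtension k q C C') :
    IsLE C' := by
  classical
  subst hq
  obtain ⟨⟨-, -, hCcard, hCagree⟩, D, rfl, hDk⟩ := hC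
  obtain ⟨⟨-, -, hcard', hagree'⟩, -, e, he⟩ := hC'
  obtain ⟨p, hp⟩ := exists_eq_succAbove e
  simp only [hp] at he
  have hinj : Set.InjOn (fun (w : Fin (n + 1) → F) (i : Fin n) => w (p.succAbove i)) C' :=
    Set.injOn_of_ncard_image_eq (by rw [he, hCcard, hcard'])
  have hlift : ∀ u : D, ∃ w ∈ C', (fun i => w (p.succAbove i)) = u.1 := fun u => by
    have : u.1 ∈ (D : Set (Fin n → F)) := u.2
    rwa [← he] at this
  choose w hwC hw using hlift
  obtain ⟨L, h, hL⟩ := exists_perm_linear_of_column D hDk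
    (fun u hu hu0 => hCagree u hu 0 D.zero_mem hu0) (fun u => w u p) (fun u v huv hfuv => by
      have hne : w u ≠ w v := fun h => huv (Subtype.ext (by rw [← hw u, ← hw v, h]))
      refine lt_of_le_of_lt ?_ (hagree' _ (hwC u) _ (hwC v) hne)
      rw [← Set.ncard_image_of_injective _ (Fin.succAbove_right_injective (p := p)),
        ← Set.ncard_insert_of_notMem (a := p) (by rintro ⟨i, -, hi⟩; exact Fin.succAbove_ne _ _ hi)]
      refine Set.ncard_le_ncard ?_
      rintro _ (rfl | ⟨i, hi, rfl⟩)
      · exact hfuv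
      · rw [Set.mem_ofPred_eq] at hi ⊢
        rwa [← hw u, ← hw v] at hi) hn
  -- the linear code obtained from `D` by inserting the column `L` at position `p`
  let ext : D →ₗ[F] (Fin (n + 1) → F) :=
    { toFun := fun u => p.insertNth (L u) u.1
      map_add' := fun u v => by
        funext i
        refine Fin.succAboveCases p ?_ (fun j => ?_) i <;> simp
      map_smul' := fun a u => by
        funext i
        refine Fin.succAboveCases p ?_ (fun j => ?_) i <;> simp }
  have hext : ∀ u : D, (fun i => (if i = p then h else 1 : Equiv.Perm F) (ext u i)) = w u := by
    intro u
    funext i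
    refine Fin.succAboveCases p ?_ (fun j => ?_) i
    · simp [ext, hL]
    · simpa [ext, Fin.succAbove_ne] using (congrFun (hw u) j).symm
  refine ⟨LinearMap.range ext, 1, fun i => if i = p then h else 1, ?_⟩
  refine Set.Subset.antisymm (fun x hx => ?_) ?_
  · have hxD : (fun i => x (p.succAbove i)) ∈ D := by
      rw [← SetLike.mem_coe, ← he]
      exact ⟨x, hx, rfl⟩
    refine ⟨ext ⟨_, hxD⟩, ⟨_, rfl⟩, (hext ⟨_, hxD⟩).trans ?_⟩
    exact hinj (hwC _) hx (hw _)
  · rintro _ ⟨_, ⟨u, rfl⟩, rfl⟩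
    have := hwC u
    rwa [← hext u] at this
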